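/- Let $d\ge 1$, $D=[0,1]^d$, $\Omega=D\times[0,1]\subset\mathbb{R}^{d+1}$. For a continuously differentiable map $h$ on a set $S\in\{D,\Omega\}$ (up to the boundary) with values in $\mathbb{R}^d$, let $\|h\|_{C^1(S)}$ be the maximum of the suprema over $S$ of $|h_k|$ and of $|\partial_j h_k|$, over all components $h_k$ and all coordinate directions $j$ (for $S=\Omega$ including the time direction). Let $\mathcal V$ be the set of admissible velocity fields, i.e. of all $f\in C^1(\Omega,\mathbb{R}^d)$ such that $f(x,t)\cdot\nu_x=0$ for all $t\in[0,1]$ and all $x\in\partial D$ at which the outward unit normal $\nu_x$ of $D$ is defined. For $f\in\mathcal V$ let $X^f(x,\cdot):[0,1]\to D$, $x\in D$, be the solution of $$\tfrac{d}{dt}X^f(x,t)=f(X^f(x,t),t),\quad t\in[0,1],\qquad X^f(x,0)=x,$$ and let $T^f=X^f(\cdot,1):D\to D$ be the time-one flow map. Fix $r>0$, and let $f,g\in\mathcal V$ satisfy $$\max\Big\{\|f\|_{C^1(\Omega)},\ \sup_{t\in[0,1]}|\nabla_x f(\cdot,t)|_{\mathrm{Lip}(D)}\Big\}\le r,\qquad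 \|g\|_{C^1(\Omega)}\le r,$$ where $|\cdot|_{\mathrm{Lip}(D)}$ is the Lipschitz constant on $D$ with respect to the Euclidean norm on $D$ and the operator norm on matrices (in particular, this holds if the Lipschitz constant with respect to the Frobenius norm is at most $r$). Then the solutions $X^f(x,\cdot)$ and $X^g(x,\cdot)$ exist in $D$ on $[0,1]$ and are unique for every $x\in D$, the maps $T^f,T^g$ are continuously differentiable on $D$, and $$\|T^f-T^g\|_{C^1(D)}\le C\,\|f-g\|_{C^1(\Omega)},\qquad C=\max\Big\{e^{dr},\ \frac{re^{3dr}+2de^{2dr}}{2\sqrt d\,r}\Big\}.$$ -/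

import Mathlib

open scoped ENNReal

namespace ODEFlow

/-- Euclidean space `ℝ^d`. -/
abbrev E (d : ℕ) : Type := EuclideanSpace ℝ (Fin d)

/-- The closed unit cube `D = [0,1]^d`. -/
def cube (d : ℕ) : Set (E d) := {x | ∀ i, x i ∈ Set.Icc (0 : ℝ) 1}

/-- The space-time cylinder `Ω = D × [0,1]`. -/
def cylinder (d : ℕ) : Set (E d × ℝ) := cube d ×ˢ Set.Icc (0 : ℝ) 1

/-- The coordinate directions of `ℝ^d`. -/
noncomputable def spaceDir (d : ℕ) (j : Fin d) : E d := EuclideanSpace.single j 1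

/-- The `d + 1` coordinate directions of space-time: `none` is the time direction. -/
noncomputable def spaceTimeDir (d : ℕ) : Option (Fin d) → E d × ℝ
  | some j => (spaceDir d j, 0)
  | none => (0, 1)

/-- The `C^1` norm on `S` of a vector field `f`, continuously differentiable on `S`: the largest
of the suprema over `S` of the absolute values of the components `f_k` and of their first order
partial derivatives in the coordinate directions `e j`. It takes values in `[0, ∞]`. -/
noncomputable def C1Norm {V ι : Type*} [NormedAddCommGroup V] [NormedSpace ℝ V] {d : ℕ}
    (S : Set V) (e : ι → V) (f : V → E d) : ℝ≥0∞ :=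
  ⨆ p ∈ S, ⨆ k : Fin d, max ‖f p k‖ₑ (⨆ j : ι, ‖fderivWithin ℝ f S p (e j) k‖ₑ)

/-- `‖T‖_{C^1(D)}` for a map `T` on the cube. -/
noncomputable def C1NormCube {d : ℕ} (T : E d → E d) : ℝ≥0∞ :=
  C1Norm (cube d) (spaceDir d) T

/-- `‖f‖_{C^1(Ω)}` for a time-dependent vector field `f`; this includes `∂_t f`. -/
noncomputable def C1NormCylinder {d : ℕ} (f : E d × ℝ → E d) : ℝ≥0∞ :=
  C1Norm (cylinder d) (spaceTimeDir d) f

/-- `ν` is the outward unit normal of the cube at `x`. It exists exactly at the points `x` of the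
boundary that lie in the relative interior of a face of dimension `d - 1`. -/
def IsOutwardNormal {d : ℕ} (x ν : E d) : Prop :=
  ∃ i : Fin d, (∀ j, j ≠ i → x j ∈ Set.Ioo (0 : ℝ) 1) ∧
    ((x i = 0 ∧ ν = -spaceDir d i) ∨ (x i = 1 ∧ ν = spaceDir d i))

/-- Admissible velocity fields: `C^1` on the closed cylinder `Ω`, with normal component vanishing
on the boundary of the cube at all times. -/
structure Admissible {d : ℕ} (f : E d × ℝ → E d) : Prop where
  contDiffOn : ContDiffOn ℝ 1 f (cylinder d)
  tangent : ∀ x ν : E d, IsOutwardNormal x ν → ∀ t ∈ Set.Icc (0 : ℝ) 1, inner ℝ (f (x, t)) ν = 0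

/-- The spatial gradient `∇_x f(·, t)` on the cube, as a linear map on Euclidean space (so with
the operator norm). -/
noncomputable def spatialGradient {d : ℕ} (f : E d × ℝ → E d) (t : ℝ) (x : E d) : E d →L[ℝ] E d :=
  fderivWithin ℝ (fun y => f (y, t)) (cube d) x

/-- `γ` solves `γ' (t) = f (γ t, t)` for `t ∈ [0,1]` with `γ 0 = x`, inside the cube. -/
structure IsTrajectory {d : ℕ} (f : E d × ℝ → E d) (x : E d) (γ : ℝ → E d) : Prop where
  initial : γ 0 = x
  mem_cube : ∀ t ∈ Set.Icc (0 : ℝ) 1, γ t ∈ cube d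
  ode : ∀ t ∈ Set.Icc (0 : ℝ) 1, HasDerivWithinAt γ (f (γ t, t)) (Set.Icc 0 1) t

open Classical in
/-- The flow `X^f(x, t)`: the trajectory of `f` started at `x` (constant if there is none). -/
noncomputable def flow {d : ℕ} (f : E d × ℝ → E d) (x : E d) : ℝ → E d :=
  if h : ∃ γ, IsTrajectory f x γ then h.choose else fun _ => x

/-- The time-one flow map `T^f = X^f(·, 1)`. -/
noncomputable def timeOneMap {d : ℕ} (f : E d × ℝ → E d) (x : E d) : E d := flow f x 1

/-- For every starting point in the cube, `X^f(x, ·)` is a trajectory of `f`, and it is the only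
one. -/
def FlowWellDefined {d : ℕ} (f : E d × ℝ → E d) : Prop :=
  ∀ x ∈ cube d, IsTrajectory f x (flow f x) ∧
    ∀ γ, IsTrajectory f x γ → Set.EqOn γ (flow f x) (Set.Icc 0 1)

end ODEFlow

namespace ODEFlow

open Set

/-! Everything is Grönwall's inequality on `[0,1]` with rate `K = d * r`: matrix entries bounded by
`r` give operator norm at most `d * r`, so by convexity of the cube the fields are `K`-Lipschitz in
space.

Existence inside the cube: precompose the field with the clamp onto the cube and apply
Picard–Lindelöf. The normal component vanishes on closed faces (`Admissible.apply_eq_zero`), so a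
coordinate that has left `[0,1]` is stationary; hence none leaves.

The derivative of the flow is the fundamental solution `J` of the variational equation, because
`X(y) - X(x) - J (y - x)` satisfies a Grönwall inequality with an error of order `o(‖y - x‖)`.

Stability: let `ε` be the `C^1` distance of the fields. Grönwall gives `‖X^f - X^g‖ ≤ ε √d (e^K -
1)/K`. The coefficients of the two variational equations then differ by at most `r ‖X^f - X^g‖ + d
ε`, and Grönwall again (`IsFundamentalSolution.norm_sub_le`) bounds `‖J - J'‖`. Both bounds lie
below `ε` times the second entry of the maximum, by `2 (e^x - 2) ≤ x e^x`. -/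

/-! ### Geometry of the cube. -/

theorem convex_cube (d : ℕ) : Convex ℝ (cube d) := by
  intro x hx y hy a b ha hb hab i
  exact convex_Icc (0 : ℝ) 1 (hx i) (hy i) ha hb hab

theorem cube_eq_preimage (d : ℕ) :
    cube d = WithLp.ofLp (p := 2) ⁻¹' Set.pi univ (fun _ : Fin d => Icc (0 : ℝ) 1) := by
  ext x; simp only [cube, mem_ofPred_eq, mem_preimage, mem_univ_pi]

theorem isCompact_cube (d : ℕ) : IsCompact (cube d) := by
  rw [cube_eq_preimage]
  exact (PiLp.homeomorph 2 (fun _ : Fin d => ℝ)).isCompact_preimage.mpr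
    (isCompact_univ_pi fun _ => isCompact_Icc)

theorem interior_cube_nonempty (d : ℕ) : (interior (cube d)).Nonempty := by
  refine ⟨WithLp.toLp 2 fun _ => 1 / 2, mem_interior.mpr
    ⟨WithLp.ofLp (p := 2) ⁻¹' Set.pi univ (fun _ : Fin d => Ioo (0 : ℝ) 1), ?_, ?_, ?_⟩⟩
  · rw [cube_eq_preimage]
    exact preimage_mono (pi_mono fun _ _ => Ioo_subset_Icc_self)
  · exact (isOpen_set_pi finite_univ fun _ _ => isOpen_Ioo).preimage
      (PiLp.continuous_ofLp 2 _)
  · simp only [mem_preimage, mem_univ_pi]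
    intro i
    constructor <;> norm_num

theorem uniqueDiffOn_cube (d : ℕ) : UniqueDiffOn ℝ (cube d) :=
  uniqueDiffOn_convex (convex_cube d) (interior_cube_nonempty d)

theorem isCompact_cylinder (d : ℕ) : IsCompact (cylinder d) :=
  (isCompact_cube d).prod isCompact_Icc

theorem uniqueDiffOn_cylinder (d : ℕ) : UniqueDiffOn ℝ (cylinder d) :=
  (uniqueDiffOn_cube d).prod (uniqueDiffOn_Icc zero_lt_one)

/-! ### Clamping and Euclidean norm comparisons. -/

/-- The coordinatewise projection onto the box `[a, b]^d`. -/
noncomputable def clamp {d : ℕ} (a b : ℝ) (x : E d) : E d :=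
  WithLp.toLp 2 fun i => max a (min b (x i))

theorem clamp_apply {d : ℕ} (a b : ℝ) (x : E d) (i : Fin d) :
    clamp a b x i = max a (min b (x i)) := rfl

theorem norm_le_norm_of_abs_le {d : ℕ} {x y : E d} (h : ∀ i, |x i| ≤ |y i|) : ‖x‖ ≤ ‖y‖ := by
  rw [EuclideanSpace.norm_eq, EuclideanSpace.norm_eq]
  refine Real.sqrt_le_sqrt (Finset.sum_le_sum fun i _ => ?_)
  simpa only [Real.norm_eq_abs] using pow_le_pow_left₀ (abs_nonneg _) (h i) 2

theorem norm_le_sqrt_mul {d : ℕ} {x : E d} {c : ℝ} (hc : 0 ≤ c) (h : ∀ i, |x i| ≤ c) :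
    ‖x‖ ≤ Real.sqrt d * c := by
  rw [EuclideanSpace.norm_eq]
  refine Real.sqrt_le_iff.mpr ⟨by positivity, ?_⟩
  calc ∑ i, ‖x i‖ ^ 2 ≤ ∑ _i : Fin d, c ^ 2 :=
        Finset.sum_le_sum fun i _ => pow_le_pow_left₀ (norm_nonneg _) (h i) 2
    _ = (Real.sqrt d * c) ^ 2 := by
        rw [mul_pow, Real.sq_sqrt (Nat.cast_nonneg d)]; simp

theorem abs_apply_le_norm {d : ℕ} (x : E d) (i : Fin d) : |x i| ≤ ‖x‖ :=
  PiLp.norm_apply_le x i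

theorem lipschitzWith_clamp {d : ℕ} (a b : ℝ) : LipschitzWith 1 (clamp (d := d) a b) := by
  refine LipschitzWith.of_dist_le_mul fun x y => ?_
  rw [NNReal.coe_one, one_mul, dist_eq_norm, dist_eq_norm]
  refine norm_le_norm_of_abs_le fun i => ?_
  simp only [PiLp.sub_apply, clamp_apply]
  refine (abs_max_sub_max_le_max _ _ _ _).trans ?_
  refine max_le (by simp) ((abs_min_sub_min_le_max _ _ _ _).trans ?_)
  exact max_le (by simp) le_rfl

theorem clamp_mem_cube {d : ℕ} (x : E d) : clamp 0 1 x ∈ cube d := fun _ =>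
  ⟨le_max_left _ _, max_le zero_le_one (min_le_left _ _)⟩

theorem clamp_of_mem_cube {d : ℕ} {x : E d} (hx : x ∈ cube d) : clamp 0 1 x = x := by
  ext i
  rw [clamp_apply, min_eq_right (hx i).2, max_eq_right (hx i).1]

theorem abs_clamp_apply_le {d : ℕ} {M : ℝ} (hM : 0 ≤ M) (x : E d) (i : Fin d) :
    |clamp (-M) M x i| ≤ M := by
  rw [clamp_apply, abs_le]
  exact ⟨le_max_left _ _, max_le (by linarith) (min_le_left _ _)⟩

theorem norm_clamp_le {d : ℕ} {M : ℝ} (hM : 0 ≤ M) (x : E d) : ‖clamp (-M) M x‖ ≤ ‖x‖ := by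
  refine norm_le_norm_of_abs_le fun i => ?_
  rw [clamp_apply, abs_le]
  constructor
  · exact le_max_of_le_right (le_min (by linarith [abs_nonneg (x i)]) (neg_abs_le _))
  · exact max_le (by linarith [abs_nonneg (x i)]) ((min_le_right _ _).trans (le_abs_self _))

theorem clamp_of_norm_le {d : ℕ} {M : ℝ} {x : E d} (hx : ‖x‖ ≤ M) : clamp (-M) M x = x := by
  ext i
  have h := abs_le.mp ((abs_apply_le_norm x i).trans hx)
  rw [clamp_apply, min_eq_right h.2, max_eq_right h.1]

/-! ### Existence, Grönwall and a barrier argument on the unit interval. -/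

/-- A bounded vector field on `[0,1]`, globally Lipschitz in space and continuous in time, has an
integral curve through every point. -/
theorem exists_integralCurve_of_bounded {V : Type*} [NormedAddCommGroup V] [NormedSpace ℝ V]
    [CompleteSpace V] (v : ℝ → V → V) (x : V) {K L : NNReal}
    (hlip : ∀ t ∈ Icc (0 : ℝ) 1, LipschitzWith K (v t))
    (hcont : ∀ y, ContinuousOn (fun t => v t y) (Icc 0 1))
    (hbound : ∀ t ∈ Icc (0 : ℝ) 1, ∀ y, ‖v t y‖ ≤ L) :
    ∃ γ : ℝ → V, γ 0 = x ∧ ∀ t ∈ Icc (0 : ℝ) 1, HasDerivWithinAt γ (v t (γ t)) (Icc 0 1) t := by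
  -- Speed at most `L` for unit time stays in the ball of radius `L` about `x`; the initial points
  -- form a ball of radius `0`.
  have h : IsPicardLindelof v (tmin := 0) (tmax := 1) ⟨0, left_mem_Icc.mpr zero_le_one⟩ x L 0 L K :=
    { lipschitzOnWith := fun t ht => (hlip t ht).lipschitzOnWith
      continuousOn := fun y _ => hcont y
      norm_le := fun t ht y _ => hbound t ht y
      mul_max_le := by simp }
  exact h.exists_eq_forall_mem_Icc_hasDerivWithinAt₀

/-- Grönwall's inequality on `[0,1]` with constant coefficients. -/
theorem norm_le_of_norm_deriv_le {V : Type*} [NormedAddCommGroup V] [NormedSpace ℝ V]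
    {w w' : ℝ → V} {K ε : ℝ} (hK : 0 < K) (hε : 0 ≤ ε)
    (hw : ∀ t ∈ Icc (0 : ℝ) 1, HasDerivWithinAt w (w' t) (Icc 0 1) t)
    (hb : ∀ t ∈ Icc (0 : ℝ) 1, ‖w' t‖ ≤ K * ‖w t‖ + ε) :
    ∀ t ∈ Icc (0 : ℝ) 1, ‖w t‖ ≤ ‖w 0‖ * Real.exp K + ε * ((Real.exp K - 1) / K) := by
  intro t ht
  have h := norm_le_gronwallBound_of_norm_deriv_right_le (f := w) (f' := w') (δ := ‖w 0‖)
    (fun s hs => (hw s hs).continuousWithinAt)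
    (fun s hs => (hw s (Ico_subset_Icc_self hs)).mono_of_mem_nhdsWithin
      (Icc_mem_nhdsGE_of_mem hs)) le_rfl
    (fun s hs => hb s (Ico_subset_Icc_self hs)) t ht
  refine (h.trans (gronwallBound_mono (norm_nonneg _) hε hK.le
    (show t - 0 ≤ 1 by linarith [ht.2]))).trans_eq ?_
  rw [gronwallBound_of_K_ne_0 hK.ne']
  simp only [mul_one]
  ring

/-- A function that is stationary wherever it is nonpositive stays nonnegative. -/
theorem nonneg_of_deriv_eq_zero_of_nonpos {u u' : ℝ → ℝ}
    (hu : ∀ t ∈ Icc (0 : ℝ) 1, HasDerivWithinAt u (u' t) (Icc 0 1) t) (h0 : 0 ≤ u 0)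
    (h : ∀ t ∈ Icc (0 : ℝ) 1, u t ≤ 0 → u' t = 0) :
    ∀ t ∈ Icc (0 : ℝ) 1, 0 ≤ u t := by
  intro t ht
  -- The barrier `ε * s` is never crossed: on contact `u ≤ 0`, so `-u` has slope `0 < ε`.
  have key : ∀ ε : ℝ, 0 < ε → -u t ≤ ε * t := by
    intro ε hε
    refine image_le_of_deriv_right_lt_deriv_boundary (f := fun s => -u s) (f' := fun s => -u' s)
      (B := fun s => ε * s) (B' := fun _ => ε) (a := 0) (b := 1)
      (fun s hs => (hu s hs).continuousWithinAt.neg)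
      (fun s hs => ((hu s (Ico_subset_Icc_self hs)).mono_of_mem_nhdsWithin
        (Icc_mem_nhdsGE_of_mem hs)).neg) (by simpa using h0)
      (fun s => by simpa using (hasDerivAt_id s).const_mul ε) ?_ ht
    intro s hs hsu
    have : u s ≤ 0 := by
      have := mul_nonneg hε.le hs.1
      linarith
    simpa [h s (Ico_subset_Icc_self hs) this] using hε
  by_contra! hneg
  have h1 := key (-u t / 2) (by linarith)
  have h2 : (-u t / 2) * t ≤ (-u t / 2) * 1 := mul_le_mul_of_nonneg_left ht.2 (by linarith)
  linarith

/-! ### Linear equations and fundamental solutions. -/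

/-- Linear differential equations on `[0,1]` have solutions with any initial value. -/
theorem exists_solution_linear {d : ℕ} (B : ℝ → E d →L[ℝ] E d) {K : ℝ} (hK : 0 < K)
    (hB : ContinuousOn B (Icc 0 1)) (hBK : ∀ t ∈ Icc (0 : ℝ) 1, ‖B t‖ ≤ K) (x : E d) :
    ∃ v : ℝ → E d, v 0 = x ∧ ∀ t ∈ Icc (0 : ℝ) 1, HasDerivWithinAt v (B t (v t)) (Icc 0 1) t := by
  -- `M` is the a priori Grönwall bound. Truncating at `M` makes the field bounded; since the clamp
  -- does not increase norms, the truncated solution obeys the same bound and the truncation is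
  -- never active.
  set M : ℝ := ‖x‖ * Real.exp K with hM
  have hM0 : 0 ≤ M := by positivity
  have hlip : ∀ t ∈ Icc (0 : ℝ) 1,
      LipschitzWith K.toNNReal (fun y => B t (clamp (-M) M y)) := by
    intro t ht
    refine LipschitzWith.of_dist_le_mul fun y z => ?_
    rw [Real.coe_toNNReal _ hK.le, dist_eq_norm, ← map_sub]
    refine ((B t).le_of_opNorm_le (hBK t ht) _).trans (mul_le_mul_of_nonneg_left ?_ hK.le)
    simpa [dist_eq_norm] using (lipschitzWith_clamp (d := d) (-M) M).dist_le_mul y z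
  have hbound : ∀ t ∈ Icc (0 : ℝ) 1, ∀ y,
      ‖B t (clamp (-M) M y)‖ ≤ (K * (Real.sqrt d * M)).toNNReal := by
    intro t ht y
    rw [Real.coe_toNNReal _ (by positivity)]
    exact ((B t).le_of_opNorm_le (hBK t ht) _).trans (mul_le_mul_of_nonneg_left
      (norm_le_sqrt_mul hM0 (abs_clamp_apply_le hM0 y)) hK.le)
  obtain ⟨v, hv0, hv⟩ := exists_integralCurve_of_bounded (fun t y => B t (clamp (-M) M y)) x
    hlip (fun y => hB.clm_apply continuousOn_const) hbound
  refine ⟨v, hv0, fun t ht => ?_⟩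
  have hn : ‖v t‖ ≤ M := by
    have := norm_le_of_norm_deriv_le hK le_rfl hv (fun s hs => by
      rw [add_zero]
      exact ((B s).le_of_opNorm_le (hBK s hs) _).trans
        (mul_le_mul_of_nonneg_left (norm_clamp_le hM0 _) hK.le)) t ht
    simpa [hv0] using this
  simpa only [clamp_of_norm_le hn] using hv t ht

/-- `J` is the fundamental solution on `[0,1]` of the linear equation with coefficient `B`. -/
structure IsFundamentalSolution {d : ℕ} (B J : ℝ → E d →L[ℝ] E d) : Prop where
  initial : J 0 = ContinuousLinearMap.id ℝ (E d)
  ode : ∀ t ∈ Icc (0 : ℝ) 1, HasDerivWithinAt J ((B t).comp (J t)) (Icc 0 1) t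

theorem exists_isFundamentalSolution {d : ℕ} (B : ℝ → E d →L[ℝ] E d) {K : ℝ} (hK : 0 < K)
    (hB : ContinuousOn B (Icc 0 1)) (hBK : ∀ t ∈ Icc (0 : ℝ) 1, ‖B t‖ ≤ K) :
    ∃ J, IsFundamentalSolution B J := by
  choose v hv0 hv using fun j => exists_solution_linear B hK hB hBK (spaceDir d j)
  let π : Fin d → E d →L[ℝ] ℝ := fun j => EuclideanSpace.proj j
  refine ⟨fun t => ∑ j, (π j).smulRight (v j t), ?_, fun t ht => ?_⟩
  · ext x i
    simp [π, hv0, spaceDir, Pi.single_apply]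
  · have h : HasDerivWithinAt (fun t => ∑ j, (π j).smulRight (v j t))
        (∑ j, (π j).smulRight (B t (v j t))) (Icc 0 1) t :=
      HasDerivWithinAt.fun_sum fun j _ =>
        (ContinuousLinearMap.smulRightL ℝ (E d) (E d) (π j)).hasFDerivAt.comp_hasDerivWithinAt t
          (hv j t ht)
    refine h.congr_deriv ?_
    ext x i
    simp

theorem IsFundamentalSolution.norm_le {d : ℕ} {B J : ℝ → E d →L[ℝ] E d} {K : ℝ} (hK : 0 < K)
    (hBK : ∀ t ∈ Icc (0 : ℝ) 1, ‖B t‖ ≤ K) (hJ : IsFundamentalSolution B J) :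
    ∀ t ∈ Icc (0 : ℝ) 1, ‖J t‖ ≤ Real.exp K := by
  intro t ht
  have h := norm_le_of_norm_deriv_le hK le_rfl hJ.ode (fun s hs => by
    rw [add_zero]
    exact (ContinuousLinearMap.opNorm_comp_le _ _).trans
      (mul_le_mul_of_nonneg_right (hBK s hs) (norm_nonneg _))) t ht
  rw [zero_mul, add_zero, hJ.initial] at h
  exact h.trans (mul_le_of_le_one_left (Real.exp_pos K).le ContinuousLinearMap.norm_id_le)

/-- Fundamental solutions depend continuously on the coefficient. -/
theorem IsFundamentalSolution.norm_sub_le {d : ℕ} {B B' J J' : ℝ → E d →L[ℝ] E d} {K η : ℝ}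
    (hK : 0 < K) (hBK : ∀ t ∈ Icc (0 : ℝ) 1, ‖B t‖ ≤ K) (hBK' : ∀ t ∈ Icc (0 : ℝ) 1, ‖B' t‖ ≤ K)
    (hη : 0 ≤ η) (hBB : ∀ t ∈ Icc (0 : ℝ) 1, ‖B t - B' t‖ ≤ η)
    (hJ : IsFundamentalSolution B J) (hJ' : IsFundamentalSolution B' J') :
    ∀ t ∈ Icc (0 : ℝ) 1,
      ‖J t - J' t‖ ≤ η * Real.exp K * ((Real.exp K - 1) / K) := by
  intro t ht
  have h := norm_le_of_norm_deriv_le (w := fun s => J s - J' s) hK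
    (show 0 ≤ η * Real.exp K by positivity)
    (fun s hs => (hJ.ode s hs).sub (hJ'.ode s hs)) (fun s hs => by
      -- The coefficient difference multiplies `J`, already bounded by `e^K`; the other term is the
      -- Grönwall feedback.
      have e : (B s).comp (J s) - (B' s).comp (J' s) =
          (B' s).comp (J s - J' s) + (B s - B' s).comp (J s) := by
        ext x : 1; simp
      rw [e]
      refine (norm_add_le _ _).trans (add_le_add ?_ ?_)
      · exact (ContinuousLinearMap.opNorm_comp_le _ _).trans
          (mul_le_mul_of_nonneg_right (hBK' s hs) (norm_nonneg _))
      · exact (ContinuousLinearMap.opNorm_comp_le _ _).trans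
          (mul_le_mul (hBB s hs) (hJ.norm_le hK hBK s hs) (norm_nonneg _) hη)) t ht
  simpa [hJ.initial, hJ'.initial] using h

/-! ### From bounds on components and entries to Euclidean and operator norms. -/

theorem C1Norm_le_iff {V ι : Type*} [NormedAddCommGroup V] [NormedSpace ℝ V] {d : ℕ}
    {S : Set V} {e : ι → V} {f : V → E d} {c : ℝ} (hc : 0 ≤ c) :
    C1Norm S e f ≤ ENNReal.ofReal c ↔
      ∀ p ∈ S, ∀ k, |f p k| ≤ c ∧ ∀ j, |fderivWithin ℝ f S p (e j) k| ≤ c := by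
  have h (a : ℝ) : ‖a‖ₑ ≤ ENNReal.ofReal c ↔ |a| ≤ c := by
    rw [← ofReal_norm, ENNReal.ofReal_le_ofReal_iff hc, Real.norm_eq_abs]
  simp only [C1Norm, iSup_le_iff, max_le_iff, h]

/-- The operator norm is controlled by a bound on the matrix entries. -/
theorem opNorm_le_of_abs_entry_le {d : ℕ} {A : E d →L[ℝ] E d} {c : ℝ} (hc : 0 ≤ c)
    (h : ∀ j k, |A (spaceDir d j) k| ≤ c) : ‖A‖ ≤ d * c := by
  refine A.opNorm_le_bound (by positivity) fun x => ?_
  have hx : x = ∑ j, x j • spaceDir d j := by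
    ext i
    simp [spaceDir, Pi.single_apply]
  -- One factor `√d` comes from the column norms, the other from Cauchy–Schwarz over the columns.
  have hcol : ∀ j, ‖A (spaceDir d j)‖ ≤ Real.sqrt d * c := fun j => norm_le_sqrt_mul hc (h j)
  have hsum : ∑ j, |x j| ≤ Real.sqrt d * ‖x‖ := by
    rw [EuclideanSpace.norm_eq, ← Real.sqrt_mul (Nat.cast_nonneg d)]
    refine Real.le_sqrt_of_sq_le ?_
    simpa using sq_sum_le_card_mul_sum_sq (s := Finset.univ) (f := fun j => |x j|)
  calc ‖A x‖ = ‖∑ j, x j • A (spaceDir d j)‖ := by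
        conv_lhs => rw [hx]
        simp only [map_sum, map_smul]
    _ ≤ ∑ j, |x j| * (Real.sqrt d * c) := by
        refine norm_sum_le_of_le _ fun j _ => ?_
        rw [norm_smul, Real.norm_eq_abs]
        exact mul_le_mul_of_nonneg_left (hcol j) (abs_nonneg _)
    _ = (∑ j, |x j|) * (Real.sqrt d * c) := by rw [Finset.sum_mul]
    _ ≤ (Real.sqrt d * ‖x‖) * (Real.sqrt d * c) :=
        mul_le_mul_of_nonneg_right hsum (by positivity)
    _ = (Real.sqrt d * Real.sqrt d) * c * ‖x‖ := by ring
    _ = d * c * ‖x‖ := by rw [Real.mul_self_sqrt (Nat.cast_nonneg d)]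

/-! ### Admissible fields and their trajectories. -/

section Field

variable {d : ℕ} {f g : E d × ℝ → E d} {r : ℝ} {x y : E d} {t : ℝ}

theorem hasFDerivWithinAt_slice (hf : DifferentiableOn ℝ f (cylinder d)) (hx : x ∈ cube d)
    (ht : t ∈ Icc (0 : ℝ) 1) :
    HasFDerivWithinAt (fun y => f (y, t))
      ((fderivWithin ℝ f (cylinder d) (x, t)).comp (ContinuousLinearMap.inl ℝ (E d) ℝ))
      (cube d) x := by
  have h : HasFDerivWithinAt (fun y : E d => (y, t)) (ContinuousLinearMap.inl ℝ (E d) ℝ)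
      (cube d) x := (hasFDerivAt_prodMk_left x t).hasFDerivWithinAt
  have hmaps : MapsTo (fun y : E d => (y, t)) (cube d) (cylinder d) := fun _ hy => ⟨hy, ht⟩
  exact ((hf (x, t) ⟨hx, ht⟩).hasFDerivWithinAt).comp x h hmaps

theorem spatialGradient_eq (hf : DifferentiableOn ℝ f (cylinder d)) (hx : x ∈ cube d)
    (ht : t ∈ Icc (0 : ℝ) 1) :
    spatialGradient f t x =
      (fderivWithin ℝ f (cylinder d) (x, t)).comp (ContinuousLinearMap.inl ℝ (E d) ℝ) :=
  (hasFDerivWithinAt_slice hf hx ht).fderivWithin (uniqueDiffOn_cube d x hx)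

theorem hasFDerivWithinAt_spatialGradient (hf : DifferentiableOn ℝ f (cylinder d))
    (hx : x ∈ cube d) (ht : t ∈ Icc (0 : ℝ) 1) :
    HasFDerivWithinAt (fun y => f (y, t)) (spatialGradient f t x) (cube d) x := by
  rw [spatialGradient_eq hf hx ht]
  exact hasFDerivWithinAt_slice hf hx ht

theorem Admissible.differentiableOn (hf : Admissible f) : DifferentiableOn ℝ f (cylinder d) :=
  hf.contDiffOn.differentiableOn one_ne_zero

theorem Admissible.continuousOn_spatialGradient (hf : Admissible f) :
    ContinuousOn (fun p : E d × ℝ => spatialGradient f p.2 p.1) (cylinder d) := by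
  have h : ContinuousOn (fderivWithin ℝ f (cylinder d)) (cylinder d) :=
    hf.contDiffOn.continuousOn_fderivWithin (uniqueDiffOn_cylinder d) le_rfl
  exact (h.clm_comp continuousOn_const).congr
    fun p hp => spatialGradient_eq hf.differentiableOn hp.1 hp.2

theorem norm_spatialGradient_le (hf : DifferentiableOn ℝ f (cylinder d)) (hr : 0 ≤ r)
    (hfr : C1NormCylinder f ≤ ENNReal.ofReal r) (hx : x ∈ cube d) (ht : t ∈ Icc (0 : ℝ) 1) :
    ‖spatialGradient f t x‖ ≤ d * r := by
  refine opNorm_le_of_abs_entry_le hr fun j k => ?_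
  rw [spatialGradient_eq hf hx ht]
  exact (((C1Norm_le_iff hr).mp hfr (x, t) ⟨hx, ht⟩ k).2 (some j))

theorem norm_le_of_C1NormCylinder_le (hr : 0 ≤ r)
    (hfr : C1NormCylinder f ≤ ENNReal.ofReal r) (hx : x ∈ cube d) (ht : t ∈ Icc (0 : ℝ) 1) :
    ‖f (x, t)‖ ≤ Real.sqrt d * r :=
  norm_le_sqrt_mul hr fun k => ((C1Norm_le_iff hr).mp hfr (x, t) ⟨hx, ht⟩ k).1

theorem norm_sub_le_of_C1NormCylinder_le (hf : DifferentiableOn ℝ f (cylinder d)) (hr : 0 ≤ r)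
    (hfr : C1NormCylinder f ≤ ENNReal.ofReal r) (hx : x ∈ cube d) (hy : y ∈ cube d)
    (ht : t ∈ Icc (0 : ℝ) 1) : ‖f (y, t) - f (x, t)‖ ≤ d * r * ‖y - x‖ :=
  (convex_cube d).norm_image_sub_le_of_norm_hasFDerivWithin_le
    (fun _ hz => hasFDerivWithinAt_spatialGradient hf hz ht)
    (fun _ hz => norm_spatialGradient_le hf hr hfr hz ht) hx hy

theorem spatialGradient_sub (hf : DifferentiableOn ℝ f (cylinder d))
    (hg : DifferentiableOn ℝ g (cylinder d)) (hx : x ∈ cube d) (ht : t ∈ Icc (0 : ℝ) 1) :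
    spatialGradient (fun p => f p - g p) t x = spatialGradient f t x - spatialGradient g t x :=
  ((hasFDerivWithinAt_spatialGradient hf hx ht).sub
    (hasFDerivWithinAt_spatialGradient hg hx ht)).fderivWithin (uniqueDiffOn_cube d x hx)

/-- The normal component of an admissible field vanishes on the closed faces of the cube. -/
theorem Admissible.apply_eq_zero (hf : Admissible f) (hx : x ∈ cube d) (ht : t ∈ Icc (0 : ℝ) 1)
    {i : Fin d} (hi : x i = 0 ∨ x i = 1) : f (x, t) i = 0 := by
  -- `c` is the centre of the face containing `x`. The segment from `x` to `c` enters the relative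
  -- interior of that face at once, where the normal exists; continuity then reaches `x`.
  let c : E d := WithLp.toLp 2 fun j => if j = i then x i else 1 / 2
  have hcj : ∀ j, j ≠ i → c j = 1 / 2 := fun j hj => if_neg hj
  have hci : c i = x i := if_pos rfl
  let p : ℝ → E d := fun s => x + s • (c - x)
  have hpi : ∀ s, p s i = x i := fun s => by simp [p, hci]
  have hpj : ∀ s ∈ Ioc (0 : ℝ) 1, ∀ j, j ≠ i → p s j ∈ Ioo (0 : ℝ) 1 := by
    intro s hs j hj
    have e : p s j = x j + s * (1 / 2 - x j) := by simp [p, hcj j hj]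
    obtain ⟨h0, h1⟩ := hx j
    obtain ⟨hs0, hs1⟩ := hs
    rw [e]
    constructor <;> nlinarith [mul_nonneg (sub_nonneg.mpr hs1) h0,
      mul_nonneg (sub_nonneg.mpr hs1) (sub_nonneg.mpr h1)]
  have hpc : ∀ s ∈ Icc (0 : ℝ) 1, p s ∈ cube d := by
    intro s hs
    refine (convex_cube d).add_smul_sub_mem hx (fun j => ?_) hs
    by_cases hj : j = i
    · rw [hj, hci]; exact hx i
    · rw [hcj j hj]; constructor <;> norm_num
  have hzero : ∀ s ∈ Ioc (0 : ℝ) 1, f (p s, t) i = 0 := by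
    intro s hs
    rcases hi with hi | hi
    · have := hf.tangent (p s) (-spaceDir d i) ⟨i, hpj s hs, Or.inl ⟨by rw [hpi, hi], rfl⟩⟩ t ht
      simpa [spaceDir, EuclideanSpace.inner_single_right] using this
    · have := hf.tangent (p s) (spaceDir d i) ⟨i, hpj s hs, Or.inr ⟨by rw [hpi, hi], rfl⟩⟩ t ht
      simpa [spaceDir, EuclideanSpace.inner_single_right] using this
  have hcont : ContinuousOn (fun s => f (p s, t) i) (Icc 0 1) := by
    have h1 : ContinuousOn (fun s => f (p s, t)) (Icc 0 1) :=
      hf.contDiffOn.continuousOn.comp (by fun_prop) fun s hs => ⟨hpc s hs, ht⟩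
    exact (EuclideanSpace.proj (𝕜 := ℝ) i).continuous.comp_continuousOn h1
  have hcl : EqOn (fun s => f (p s, t) i) (fun _ => 0) (Icc 0 1) :=
    EqOn.of_subset_closure (s := Ioc 0 1) hzero hcont continuousOn_const Ioc_subset_Icc_self
      (closure_Ioc (zero_ne_one' ℝ)).ge
  simpa [p] using hcl (left_mem_Icc.mpr zero_le_one)

theorem Admissible.exists_isTrajectory (hf : Admissible f) (hr : 0 ≤ r)
    (hfr : C1NormCylinder f ≤ ENNReal.ofReal r) (hx : x ∈ cube d) :
    ∃ γ, IsTrajectory f x γ := by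
  have hlip : ∀ t ∈ Icc (0 : ℝ) 1,
      LipschitzWith (d * r).toNNReal (fun y => f (clamp 0 1 y, t)) := by
    intro t ht
    refine LipschitzWith.of_dist_le_mul fun y z => ?_
    rw [Real.coe_toNNReal _ (by positivity), dist_eq_norm]
    refine (norm_sub_le_of_C1NormCylinder_le hf.differentiableOn hr hfr (clamp_mem_cube z)
      (clamp_mem_cube y) ht).trans (mul_le_mul_of_nonneg_left ?_ (by positivity))
    simpa [dist_eq_norm] using (lipschitzWith_clamp (d := d) 0 1).dist_le_mul y z
  have hcont : ∀ y, ContinuousOn (fun t => f (clamp 0 1 y, t)) (Icc 0 1) := fun y =>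
    hf.contDiffOn.continuousOn.comp (by fun_prop) fun s hs => ⟨clamp_mem_cube y, hs⟩
  have hbound : ∀ t ∈ Icc (0 : ℝ) 1, ∀ y,
      ‖f (clamp 0 1 y, t)‖ ≤ (Real.sqrt d * r).toNNReal := by
    intro t ht y
    rw [Real.coe_toNNReal _ (by positivity)]
    exact norm_le_of_C1NormCylinder_le hr hfr (clamp_mem_cube y) ht
  obtain ⟨γ, hγ0, hγ⟩ := exists_integralCurve_of_bounded (fun t y => f (clamp 0 1 y, t)) x
    hlip hcont hbound
  have hcoord : ∀ i, ∀ t ∈ Icc (0 : ℝ) 1,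
      HasDerivWithinAt (fun s => γ s i) (f (clamp 0 1 (γ t), t) i) (Icc 0 1) t := fun i t ht =>
    (EuclideanSpace.proj (𝕜 := ℝ) i).hasFDerivAt.comp_hasDerivWithinAt t (hγ t ht)
  -- Where `γ s i` lies outside `(0,1)`, the clamped point is on a face normal to direction `i`, so
  -- that velocity component is zero. The barrier lemma applies to `γ i` and `1 - γ i`.
  have hmem : ∀ t ∈ Icc (0 : ℝ) 1, γ t ∈ cube d := by
    intro t ht i
    constructor
    · refine nonneg_of_deriv_eq_zero_of_nonpos (hcoord i) (by rw [hγ0]; exact (hx i).1)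
        (fun s hs hneg => hf.apply_eq_zero (clamp_mem_cube _) hs (Or.inl ?_)) t ht
      rw [clamp_apply]
      exact max_eq_left ((min_le_right _ _).trans hneg)
    · refine sub_nonneg.mp (nonneg_of_deriv_eq_zero_of_nonpos
        (fun s hs => (hcoord i s hs).const_sub 1) (by rw [hγ0]; exact sub_nonneg.mpr (hx i).2)
        (fun s hs hneg => ?_) t ht)
      rw [hf.apply_eq_zero (clamp_mem_cube _) hs (Or.inr ?_), neg_zero]
      rw [clamp_apply, min_eq_left (by linarith), max_eq_right zero_le_one]
  refine ⟨γ, hγ0, hmem, fun t ht => ?_⟩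
  simpa only [clamp_of_mem_cube (hmem t ht)] using hγ t ht

/-- Trajectories of nearby fields with nearby starting points stay close. -/
theorem IsTrajectory.norm_sub_le {γ γ' : ℝ → E d} {ε : ℝ}
    (hf : DifferentiableOn ℝ f (cylinder d)) (hr : 0 < r) (hd : 0 < d)
    (hfr : C1NormCylinder f ≤ ENNReal.ofReal r) (hε : 0 ≤ ε)
    (hfg : ∀ z ∈ cube d, ∀ t ∈ Icc (0 : ℝ) 1, ‖f (z, t) - g (z, t)‖ ≤ ε)
    (h : IsTrajectory f x γ) (h' : IsTrajectory g y γ') :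
    ∀ t ∈ Icc (0 : ℝ) 1, ‖γ t - γ' t‖ ≤
      ‖x - y‖ * Real.exp (d * r) + ε * ((Real.exp (d * r) - 1) / (d * r)) := by
  have hK : 0 < (d : ℝ) * r := mul_pos (Nat.cast_pos.mpr hd) hr
  rw [← h.initial, ← h'.initial]
  refine norm_le_of_norm_deriv_le (w := fun s => γ s - γ' s) hK hε
    (fun s hs => (h.ode s hs).sub (h'.ode s hs)) fun s hs => ?_
  rw [← sub_add_sub_cancel _ (f (γ' s, s))]
  exact (norm_add_le _ _).trans (add_le_add
    (norm_sub_le_of_C1NormCylinder_le hf hr.le hfr (h'.mem_cube s hs) (h.mem_cube s hs) hs)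
    (hfg _ (h'.mem_cube s hs) s hs))

theorem Admissible.isTrajectory_flow (hf : Admissible f) (hr : 0 ≤ r)
    (hfr : C1NormCylinder f ≤ ENNReal.ofReal r) (hx : x ∈ cube d) :
    IsTrajectory f x (flow f x) := by
  have h := hf.exists_isTrajectory hr hfr hx
  rw [flow, dif_pos h]
  exact h.choose_spec

theorem Admissible.flowWellDefined (hf : Admissible f) (hr : 0 < r) (hd : 0 < d)
    (hfr : C1NormCylinder f ≤ ENNReal.ofReal r) : FlowWellDefined f := by
  refine fun x hx => ⟨hf.isTrajectory_flow hr.le hfr hx, fun γ hγ t ht => ?_⟩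
  have h := hγ.norm_sub_le (g := f) hf.differentiableOn hr hd hfr le_rfl (by simp)
    (hf.isTrajectory_flow hr.le hfr hx) t ht
  rw [sub_self, norm_zero, zero_mul, zero_mul, add_zero] at h
  exact sub_eq_zero.mp (norm_le_zero_iff.mp h)

end Field

/-! ### Differentiability of the flow map. -/

section Flow

variable {d : ℕ} {f g : E d × ℝ → E d} {r : ℝ} {x y : E d} {t : ℝ}

theorem Admissible.continuousOn_spatialGradient_flow (hf : Admissible f) (hr : 0 ≤ r)
    (hfr : C1NormCylinder f ≤ ENNReal.ofReal r) (hx : x ∈ cube d) :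
    ContinuousOn (fun t => spatialGradient f t (flow f x t)) (Icc 0 1) := by
  have h := hf.isTrajectory_flow hr hfr hx
  have hc : ContinuousOn (fun t => (flow f x t, t)) (Icc 0 1) :=
    ContinuousOn.prodMk (fun t ht => (h.ode t ht).continuousWithinAt) continuousOn_id
  have hmaps : MapsTo (fun t => (flow f x t, t)) (Icc 0 1) (cylinder d) :=
    fun t ht => ⟨h.mem_cube t ht, ht⟩
  exact hf.continuousOn_spatialGradient.comp hc hmaps

/-- The fundamental solution of the variational equation along the trajectory from `x`. -/
abbrev IsVariation (f : E d × ℝ → E d) (x : E d) (J : ℝ → E d →L[ℝ] E d) : Prop :=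
  IsFundamentalSolution (fun t => spatialGradient f t (flow f x t)) J

theorem Admissible.norm_spatialGradient_flow_le (hf : Admissible f) (hr : 0 ≤ r)
    (hfr : C1NormCylinder f ≤ ENNReal.ofReal r) (hx : x ∈ cube d) :
    ∀ t ∈ Icc (0 : ℝ) 1, ‖spatialGradient f t (flow f x t)‖ ≤ d * r := fun t ht =>
  norm_spatialGradient_le hf.differentiableOn hr hfr
    ((hf.isTrajectory_flow hr hfr hx).mem_cube t ht) ht

theorem Admissible.exists_isVariation (hf : Admissible f) (hr : 0 < r) (hd : 0 < d)
    (hfr : C1NormCylinder f ≤ ENNReal.ofReal r) (hx : x ∈ cube d) :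
    ∃ J, IsVariation f x J :=
  exists_isFundamentalSolution _ (mul_pos (Nat.cast_pos.mpr hd) hr)
    (hf.continuousOn_spatialGradient_flow hr.le hfr hx)
    (hf.norm_spatialGradient_flow_le hr.le hfr hx)

/-- Uniform continuity on the compact cylinder provides a modulus independent of `t`, as needed
along whole trajectories. -/
theorem Admissible.exists_dist_spatialGradient_lt (hf : Admissible f) {η : ℝ} (hη : 0 < η) :
    ∃ δ > 0, ∀ x ∈ cube d, ∀ y ∈ cube d, ‖x - y‖ < δ → ∀ t ∈ Icc (0 : ℝ) 1,
      ‖spatialGradient f t x - spatialGradient f t y‖ ≤ η := by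
  obtain ⟨δ, hδ, h⟩ := Metric.uniformContinuousOn_iff.mp
    ((isCompact_cylinder d).uniformContinuousOn_of_continuous hf.continuousOn_spatialGradient)
    η hη
  refine ⟨δ, hδ, fun x hx y hy hxy t ht => ?_⟩
  rw [← dist_eq_norm]
  refine (h (x, t) ⟨hx, ht⟩ (y, t) ⟨hy, ht⟩ ?_).le
  rwa [dist_prod_same_right, dist_eq_norm]

theorem Admissible.norm_flow_sub_le (hf : Admissible f) (hr : 0 < r) (hd : 0 < d)
    (hfr : C1NormCylinder f ≤ ENNReal.ofReal r) (hx : x ∈ cube d) (hy : y ∈ cube d)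
    (ht : t ∈ Icc (0 : ℝ) 1) :
    ‖flow f y t - flow f x t‖ ≤ ‖y - x‖ * Real.exp (d * r) := by
  have h := (hf.isTrajectory_flow hr.le hfr hy).norm_sub_le (g := f) hf.differentiableOn hr hd hfr
    le_rfl (by simp) (hf.isTrajectory_flow hr.le hfr hx) t ht
  simpa using h

/-- The flow map is differentiable; its derivative solves the variational equation. -/
theorem Admissible.hasFDerivWithinAt_timeOneMap (hf : Admissible f) (hr : 0 < r) (hd : 0 < d)
    (hfr : C1NormCylinder f ≤ ENNReal.ofReal r) (hx : x ∈ cube d) {J : ℝ → E d →L[ℝ] E d}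
    (hJ : IsVariation f x J) : HasFDerivWithinAt (timeOneMap f) (J 1) (cube d) x := by
  have hK : 0 < (d : ℝ) * r := mul_pos (Nat.cast_pos.mpr hd) hr
  set K : ℝ := d * r with hKdef
  have hexp_sub : 0 < Real.exp K - 1 := sub_pos.mpr (Real.one_lt_exp_iff.mpr hK)
  rw [hasFDerivWithinAt_iff_isLittleO, Asymptotics.isLittleO_iff]
  intro c hc
  -- Chosen so that the final Grönwall bound is exactly `c * ‖y - x‖`.
  set η : ℝ := c / (Real.exp K * ((Real.exp K - 1) / K)) with hηdef
  have hη : 0 < η := by positivity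
  obtain ⟨δ, hδ, hgrad⟩ := hf.exists_dist_spatialGradient_lt hη
  have hball : ∀ᶠ y in nhdsWithin x (cube d), y ∈ cube d ∧ ‖y - x‖ * Real.exp K < δ := by
    refine eventually_mem_nhdsWithin.and (nhdsWithin_le_nhds ?_)
    have hcont : Continuous fun y : E d => ‖y - x‖ * Real.exp K := by fun_prop
    exact hcont.continuousAt.eventually_lt continuousAt_const (by simpa using hδ)
  filter_upwards [hball] with y ⟨hy, hyx⟩
  have hX := hf.isTrajectory_flow hr.le hfr hx
  have hY := hf.isTrajectory_flow hr.le hfr hy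
  have hflow : ∀ t ∈ Icc (0 : ℝ) 1,
      ‖flow f y t - flow f x t‖ ≤ ‖y - x‖ * Real.exp K :=
    fun t ht => hf.norm_flow_sub_le hr hd hfr hx hy ht
  have hder : ∀ t ∈ Icc (0 : ℝ) 1,
      HasDerivWithinAt (fun s => flow f y s - flow f x s - J s (y - x))
        (f (flow f y t, t) - f (flow f x t, t) -
          spatialGradient f t (flow f x t) (J t (y - x))) (Icc 0 1) t := fun t ht =>
    ((hY.ode t ht).sub (hX.ode t ht)).sub
      (((hJ.ode t ht).clm_apply (hasDerivWithinAt_const t _ (y - x))).congr_deriv (by simp))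
  have hbound : ∀ t ∈ Icc (0 : ℝ) 1, ‖f (flow f y t, t) - f (flow f x t, t) -
      spatialGradient f t (flow f x t) (J t (y - x))‖ ≤
      K * ‖flow f y t - flow f x t - J t (y - x)‖ + η * (‖y - x‖ * Real.exp K) := by
    intro t ht
    have hXt := hX.mem_cube t ht
    -- Mean value inequality on the convex set cube ∩ ball of radius `δ`, where the gradient stays
    -- within `η` of its value at `flow f x t`.
    have hmv : ‖f (flow f y t, t) - f (flow f x t, t) -
        spatialGradient f t (flow f x t) (flow f y t - flow f x t)‖ ≤
        η * ‖flow f y t - flow f x t‖ := by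
      refine ((convex_cube d).inter (convex_ball (flow f x t) δ)
        ).norm_image_sub_le_of_norm_hasFDerivWithin_le' (𝕜 := ℝ) (f := fun z => f (z, t))
        (f' := fun z => spatialGradient f t z) (fun z hz =>
          (hasFDerivWithinAt_spatialGradient hf.differentiableOn hz.1 ht).mono inter_subset_left)
        (fun z hz => hgrad z hz.1 _ hXt (by simpa [dist_eq_norm] using hz.2) t ht)
        ⟨hXt, Metric.mem_ball_self hδ⟩ ⟨hY.mem_cube t ht, ?_⟩
      rw [Metric.mem_ball, dist_eq_norm]
      exact (hflow t ht).trans_lt hyx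
    have e : f (flow f y t, t) - f (flow f x t, t) -
        spatialGradient f t (flow f x t) (J t (y - x)) =
        spatialGradient f t (flow f x t) (flow f y t - flow f x t - J t (y - x)) +
        (f (flow f y t, t) - f (flow f x t, t) -
          spatialGradient f t (flow f x t) (flow f y t - flow f x t)) := by
      rw [map_sub _ (flow f y t - flow f x t)]; abel
    rw [e]
    exact (norm_add_le _ _).trans (add_le_add
      (ContinuousLinearMap.le_of_opNorm_le _
        (hf.norm_spatialGradient_flow_le hr.le hfr hx t ht) _)
      (hmv.trans (mul_le_mul_of_nonneg_left (hflow t ht) hη.le)))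
  have h := norm_le_of_norm_deriv_le hK (by positivity) hder hbound 1
    (right_mem_Icc.mpr zero_le_one)
  rw [hX.initial, hY.initial, hJ.initial, ContinuousLinearMap.id_apply, sub_self, norm_zero,
    zero_mul, zero_add] at h
  refine h.trans_eq ?_
  rw [hηdef]
  field_simp

theorem Admissible.contDiffOn_timeOneMap (hf : Admissible f) (hr : 0 < r) (hd : 0 < d)
    (hfr : C1NormCylinder f ≤ ENNReal.ofReal r) :
    ContDiffOn ℝ 1 (timeOneMap f) (cube d) := by
  have hK : 0 < (d : ℝ) * r := mul_pos (Nat.cast_pos.mpr hd) hr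
  set K : ℝ := d * r with hKdef
  have hexp_sub : 0 < Real.exp K - 1 := sub_pos.mpr (Real.one_lt_exp_iff.mpr hK)
  have hone : (1 : ℝ) ∈ Icc (0 : ℝ) 1 := right_mem_Icc.mpr zero_le_one
  rw [show (1 : WithTop ℕ∞) = 0 + 1 from rfl,
    contDiffOn_succ_iff_fderivWithin (uniqueDiffOn_cube d)]
  refine ⟨fun x hx => ?_, by simp, contDiffOn_zero.mpr fun x hx => ?_⟩
  · obtain ⟨J, hJ⟩ := hf.exists_isVariation hr hd hfr hx
    exact (hf.hasFDerivWithinAt_timeOneMap hr hd hfr hx hJ).differentiableWithinAt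
  rw [Metric.continuousWithinAt_iff]
  intro c hc
  -- Half of `c`, since Grönwall gives `≤` and continuity asks for `<`.
  set η : ℝ := c / 2 / (Real.exp K * ((Real.exp K - 1) / K)) with hηdef
  have hη : 0 < η := by positivity
  obtain ⟨δ, hδ, hgrad⟩ := hf.exists_dist_spatialGradient_lt hη
  refine ⟨δ / Real.exp K, by positivity, fun y hy hyx => ?_⟩
  obtain ⟨J, hJ⟩ := hf.exists_isVariation hr hd hfr hx
  obtain ⟨J', hJ'⟩ := hf.exists_isVariation hr hd hfr hy
  rw [(hf.hasFDerivWithinAt_timeOneMap hr hd hfr hx hJ).fderivWithin (uniqueDiffOn_cube d x hx),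
    (hf.hasFDerivWithinAt_timeOneMap hr hd hfr hy hJ').fderivWithin (uniqueDiffOn_cube d y hy),
    dist_eq_norm]
  rw [dist_eq_norm, lt_div_iff₀ (Real.exp_pos K)] at hyx
  have h := hJ'.norm_sub_le hK (hf.norm_spatialGradient_flow_le hr.le hfr hy)
    (hf.norm_spatialGradient_flow_le hr.le hfr hx) hη.le (fun t ht =>
      hgrad _ ((hf.isTrajectory_flow hr.le hfr hy).mem_cube t ht) _
        ((hf.isTrajectory_flow hr.le hfr hx).mem_cube t ht)
        ((hf.norm_flow_sub_le hr hd hfr hx hy ht).trans_lt hyx) t ht) hJ 1 hone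
  refine h.trans_lt ?_
  have e : η * Real.exp K * ((Real.exp K - 1) / K) = c / 2 := by
    rw [hηdef]
    field_simp
  rw [e]
  exact half_lt_self hc

end Flow

/-! ### The numerical constants. -/

/-- The elementary inequality behind the constant in the stability estimate. -/
theorem two_mul_exp_sub_two_le (x : ℝ) : 2 * (Real.exp x - 2) ≤ x * Real.exp x := by
  -- The claim is `(2 - x) e^x ≤ 4`; the tangent-line bound for `exp` at `1 - x` gives `≤ e`.
  have h1 : (1 - x) + 1 ≤ Real.exp (1 - x) := Real.add_one_le_exp _
  have h2 : (2 - x) * Real.exp x ≤ Real.exp 1 := by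
    calc (2 - x) * Real.exp x ≤ Real.exp (1 - x) * Real.exp x :=
          mul_le_mul_of_nonneg_right (by linarith) (Real.exp_pos x).le
      _ = Real.exp 1 := by rw [← Real.exp_add]; ring_nf
  have h3 := Real.exp_one_lt_d9
  nlinarith

/-- The left side is the bound on `‖J - J'‖` per unit of `ε`. With `F = e^{Dr}` and `s = √D` it
reduces to `2 (F - 1)^2 + 2 s^3 (F - 1) ≤ s^2 r F^2 + 2 s^4 F`, which follows from `2 (F - 2) ≤ D r
F` and `s ≥ 1`. -/
theorem flow_derivative_constant_le {D r : ℝ} (hD : 1 ≤ D) (hr : 0 < r) :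
    (r * (Real.sqrt D * ((Real.exp (D * r) - 1) / (D * r))) + D) * Real.exp (D * r) *
        ((Real.exp (D * r) - 1) / (D * r)) ≤
      (r * Real.exp (3 * D * r) + 2 * D * Real.exp (2 * D * r)) / (2 * Real.sqrt D * r) := by
  set s : ℝ := Real.sqrt D with hs
  have hs1 : 1 ≤ s := Real.one_le_sqrt.mpr hD
  have hD2 : D = s ^ 2 := (Real.sq_sqrt (by linarith)).symm
  set F : ℝ := Real.exp (D * r) with hF
  have h3 : Real.exp (3 * D * r) = F ^ 3 := by
    rw [hF, ← Real.exp_nat_mul]; congr 1; push_cast; ring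
  have h2 : Real.exp (2 * D * r) = F ^ 2 := by
    rw [hF, ← Real.exp_nat_mul]; congr 1; push_cast; ring
  have hx : 0 < D * r := by positivity
  have hF1 : 1 < F := Real.one_lt_exp_iff.mpr hx
  have key : 2 * (F - 2) ≤ D * r * F := two_mul_exp_sub_two_le _
  rw [h3, h2, hD2] at *
  have e : (r * (s * ((F - 1) / (s ^ 2 * r))) + s ^ 2) * F * ((F - 1) / (s ^ 2 * r)) =
      F * (2 * ((F - 1) ^ 2 + s ^ 3 * (F - 1))) / (2 * s ^ 3 * r) := by
    field_simp
  have e' : (r * F ^ 3 + 2 * s ^ 2 * F ^ 2) / (2 * s * r) =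
      F * (s ^ 2 * r * F ^ 2 + 2 * s ^ 4 * F) / (2 * s ^ 3 * r) := by
    field_simp
  rw [e, e']
  have hs0 : 0 < s := by linarith
  have hs3 : 1 ≤ s ^ 3 := one_le_pow₀ hs1
  have hs4 : s ^ 3 ≤ s ^ 4 := pow_le_pow_right₀ hs1 (by norm_num)
  refine div_le_div_of_nonneg_right (mul_le_mul_of_nonneg_left ?_ (by linarith)) (by positivity)
  have k1 : F * (2 * (F - 2)) ≤ F * (s ^ 2 * r * F) :=
    mul_le_mul_of_nonneg_left key (by linarith)
  have k2 : s ^ 3 * F ≤ s ^ 4 * F := mul_le_mul_of_nonneg_right hs4 (by linarith)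
  nlinarith

/-- The zeroth-order constant is dominated by the derivative constant, since `√D ≤ D` and `e^{Dr} ≥
1`. -/
theorem flow_constant_le {D r : ℝ} (hD : 1 ≤ D) (hr : 0 < r) :
    Real.sqrt D * ((Real.exp (D * r) - 1) / (D * r)) ≤
      (r * Real.exp (3 * D * r) + 2 * D * Real.exp (2 * D * r)) / (2 * Real.sqrt D * r) := by
  refine le_trans ?_ (flow_derivative_constant_le hD hr)
  have hF : 1 ≤ Real.exp (D * r) := Real.one_le_exp (by positivity)
  have hF0 : 0 ≤ Real.exp (D * r) - 1 := sub_nonneg.mpr hF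
  have hs : Real.sqrt D ≤ D := Real.sqrt_le_iff.mpr ⟨by linarith, by nlinarith⟩
  refine mul_le_mul_of_nonneg_right ?_ (by positivity)
  calc Real.sqrt D ≤ D * 1 := by linarith
    _ ≤ (r * (Real.sqrt D * ((Real.exp (D * r) - 1) / (D * r))) + D) * Real.exp (D * r) :=
        mul_le_mul (le_add_of_nonneg_left (by positivity)) hF zero_le_one (by positivity)

end ODEFlow

/-! ### The stability estimate. -/

theorem mainTheorem9 (d : ℕ) (hd : 1 ≤ d) (r : ℝ) (hr : 0 < r)
    (f g : ODEFlow.E d × ℝ → ODEFlow.E d)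
    (hf : ODEFlow.Admissible f) (hg : ODEFlow.Admissible g)
    (hfr : ODEFlow.C1NormCylinder f ≤ ENNReal.ofReal r)
    (hfLip : ∀ t ∈ Set.Icc (0 : ℝ) 1,
      LipschitzOnWith (Real.toNNReal r) (ODEFlow.spatialGradient f t) (ODEFlow.cube d))
    (hgr : ODEFlow.C1NormCylinder g ≤ ENNReal.ofReal r) :
    ODEFlow.FlowWellDefined f ∧ ODEFlow.FlowWellDefined g ∧
    ContDiffOn ℝ 1 (ODEFlow.timeOneMap f) (ODEFlow.cube d) ∧
    ContDiffOn ℝ 1 (ODEFlow.timeOneMap g) (ODEFlow.cube d) ∧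
    ODEFlow.C1NormCube (fun x => ODEFlow.timeOneMap f x - ODEFlow.timeOneMap g x) ≤
      ENNReal.ofReal
        (max (Real.exp (d * r))
          ((r * Real.exp (3 * d * r) + 2 * d * Real.exp (2 * d * r)) / (2 * Real.sqrt d * r))) *
      ODEFlow.C1NormCylinder (fun p => f p - g p) := by
  have hd0 : 0 < d := hd
  have hD : (1 : ℝ) ≤ d := Nat.one_le_cast.mpr hd
  have hK : 0 < (d : ℝ) * r := by positivity
  refine ⟨hf.flowWellDefined hr hd0 hfr, hg.flowWellDefined hr hd0 hgr,
    hf.contDiffOn_timeOneMap hr hd0 hfr, hg.contDiffOn_timeOneMap hr hd0 hgr, ?_⟩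
  set C : ℝ := (r * Real.exp (3 * d * r) + 2 * d * Real.exp (2 * d * r)) /
    (2 * Real.sqrt d * r) with hC
  have hmax : 0 < max (Real.exp (d * r)) C := lt_max_of_lt_left (Real.exp_pos _)
  by_cases htop : ODEFlow.C1NormCylinder (fun p => f p - g p) = ⊤
  · rw [htop, ENNReal.mul_top (ENNReal.ofReal_pos.mpr hmax).ne']
    exact le_top
  obtain ⟨ε, hε, hfg⟩ : ∃ ε : ℝ, 0 ≤ ε ∧
      ODEFlow.C1NormCylinder (fun p => f p - g p) = ENNReal.ofReal ε :=
    ⟨_, ENNReal.toReal_nonneg, (ENNReal.ofReal_toReal htop).symm⟩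
  rw [hfg, ← ENNReal.ofReal_mul hmax.le]
  refine (ODEFlow.C1Norm_le_iff (by positivity)).mpr fun x hx k => ?_
  have hX := hf.isTrajectory_flow hr.le hfr hx
  have hY := hg.isTrajectory_flow hr.le hgr hx
  have hdiff : ∀ t ∈ Set.Icc (0 : ℝ) 1, ‖ODEFlow.flow f x t - ODEFlow.flow g x t‖ ≤
      ε * (Real.sqrt d * ((Real.exp (d * r) - 1) / (d * r))) := by
    intro t ht
    have h := hX.norm_sub_le hf.differentiableOn hr hd0 hfr
      (show 0 ≤ Real.sqrt d * ε by positivity)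
      (fun z hz s hs => ODEFlow.norm_le_of_C1NormCylinder_le
        (f := fun p => f p - g p) hε hfg.le hz hs) hY t ht
    rw [sub_self, norm_zero, zero_mul, zero_add] at h
    exact h.trans_eq (by ring)
  have hCε : ε * C ≤ max (Real.exp (d * r)) C * ε := by
    rw [mul_comm]
    exact mul_le_mul_of_nonneg_right (le_max_right _ _) hε
  have hone : (1 : ℝ) ∈ Set.Icc (0 : ℝ) 1 := Set.right_mem_Icc.mpr zero_le_one
  refine ⟨?_, fun j => ?_⟩
  · exact (ODEFlow.abs_apply_le_norm _ k).trans ((hdiff 1 hone).trans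
      ((mul_le_mul_of_nonneg_left (ODEFlow.flow_constant_le hD hr) hε).trans hCε))
  · obtain ⟨J, hJ⟩ := hf.exists_isVariation hr hd0 hfr hx
    obtain ⟨J', hJ'⟩ := hg.exists_isVariation hr hd0 hgr hx
    rw [((hf.hasFDerivWithinAt_timeOneMap hr hd0 hfr hx hJ).fun_sub
      (hg.hasFDerivWithinAt_timeOneMap hr hd0 hgr hx hJ')).fderivWithin
        (ODEFlow.uniqueDiffOn_cube d x hx)]
    have hcoef : ∀ t ∈ Set.Icc (0 : ℝ) 1,
        ‖ODEFlow.spatialGradient f t (ODEFlow.flow f x t) -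
          ODEFlow.spatialGradient g t (ODEFlow.flow g x t)‖ ≤
        ε * (r * (Real.sqrt d * ((Real.exp (d * r) - 1) / (d * r))) + d) := by
      intro t ht
      -- Inserting `∇f` along the trajectory of `g`: the Lipschitz bound on `∇f` absorbs the
      -- distance of the trajectories, leaving `∇(f - g)` at a single point.
      rw [← sub_add_sub_cancel _
        (ODEFlow.spatialGradient f t (ODEFlow.flow g x t))]
      have h1 : ‖ODEFlow.spatialGradient f t (ODEFlow.flow f x t) -
          ODEFlow.spatialGradient f t (ODEFlow.flow g x t)‖ ≤
          r * (ε * (Real.sqrt d * ((Real.exp (d * r) - 1) / (d * r)))) := by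
        have h := (hfLip t ht).norm_sub_le (hX.mem_cube t ht) (hY.mem_cube t ht)
        rw [Real.coe_toNNReal _ hr.le] at h
        exact h.trans (mul_le_mul_of_nonneg_left (hdiff t ht) hr.le)
      have h2 : ‖ODEFlow.spatialGradient f t (ODEFlow.flow g x t) -
          ODEFlow.spatialGradient g t (ODEFlow.flow g x t)‖ ≤ d * ε := by
        rw [← ODEFlow.spatialGradient_sub hf.differentiableOn hg.differentiableOn
          (hY.mem_cube t ht) ht]
        exact ODEFlow.norm_spatialGradient_le
          (hf.differentiableOn.fun_sub hg.differentiableOn) hε hfg.le (hY.mem_cube t ht) ht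
      exact ((norm_add_le _ _).trans (add_le_add h1 h2)).trans_eq (by ring)
    have hexp : 0 ≤ (Real.exp (d * r) - 1) / (d * r) :=
      div_nonneg (sub_nonneg.mpr (Real.one_le_exp hK.le)) hK.le
    have hJJ := hJ.norm_sub_le hK (hf.norm_spatialGradient_flow_le hr.le hfr hx)
      (hg.norm_spatialGradient_flow_le hr.le hgr hx) (by positivity) hcoef hJ' 1 hone
    have hbasis : ‖ODEFlow.spaceDir d j‖ = 1 := by simp [ODEFlow.spaceDir]
    refine (ODEFlow.abs_apply_le_norm _ k).trans (((J 1 - J' 1).le_opNorm _).trans ?_)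
    rw [hbasis, mul_one]
    refine hJJ.trans (le_trans (le_of_eq ?_)
      ((mul_le_mul_of_nonneg_left (ODEFlow.flow_derivative_constant_le hD hr) hε).trans hCε))
    ring
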